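/- For a complex polynomial $P$ let $$\|P\|_p=\left(\frac1{2\pi}\int_0^{2\pi}|P(e^{i\theta})|^p\,d\theta\right)^{1/p}\ (0<p<\infty),\qquad \|P\|_0=\exp\left(\frac1{2\pi}\int_0^{2\pi}\log|P(e^{i\theta})|\,d\theta\right).$$ Let $P(z)=\sum_{j=0}^n a_jz^j$ be a complex polynomial of degree $n$ that does not vanish in $|z|<\rho$, where $\rho\ge1$. Then for every $0\le p<\infty$ and every $s=0,1,\dots,n-1$, $$|a_n|+\frac{|a_s|}{\binom ns}\le 2c_p\,\frac{\|P\|_p}{\|\rho^s+z\|_p},$$ where $c_p=1$ if $s=0$ and $c_p=\dfrac1{\|1+z\|_p}$ if $s>0$. Here $\|\rho^s+z\|_p$ and $\|1+z\|_p$ denote the above quantity for the polynomials $z\mapsto\rho^s+z$ and $z\mapsto1+z$. -/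

import Mathlib

open Polynomial

/-- The quantity `‖P‖_p` of a complex polynomial on the unit circle for `0 ≤ p < ∞`:
`(1/(2π) ∫₀^{2π} |P(e^{iθ})|^p dθ)^{1/p}` for `p > 0`, and the Mahler measure
`exp (1/(2π) ∫₀^{2π} log |P(e^{iθ})| dθ)` for `p = 0`
(which is `0` for the zero polynomial). -/
noncomputable def circleNorm (p : ℝ) (P : ℂ[X]) : ℝ :=
  if p = 0 then P.mahlerMeasure
  else ((2 * Real.pi)⁻¹ *
    ∫ θ in (0 : ℝ)..(2 * Real.pi), ‖P.eval (Complex.exp (θ * Complex.I))‖ ^ p) ^ (1 / p)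

/-- The constant `c_p`, which depends on `s` only through whether `s = 0`. -/
noncomputable def constC (p : ℝ) (s : ℕ) : ℝ :=
  if s = 0 then 1 else 1 / circleNorm p (1 + X)

/-!
The proof combines two inequalities for `p`-th means on the unit circle. For a polynomial `P` of
degree `n` without zeros in `‖z‖ < ρ` and `1 ≤ s`,
`‖P⁽ˢ⁾‖_p ‖ρ ^ s + z‖_p ≤ n! / (n - s)! ‖P‖_p` (`meanPow_iterate_derivative_mul_le`); and for every
polynomial `Q` of degree at most `m ≥ 1`, `(‖Q_0‖ + ‖Q_m‖) ‖1 + z‖_p ≤ 2 ‖Q‖_p`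
(`half_add_rpow_mul_meanPow_le`). For `s = 0` the second, with `Q = P`, is the claim; for `s > 0`
apply it to `Q = P⁽ˢ⁾` and then the first. For `p = 0` the Mahler measure of `P` is `‖P 0‖`, and
both coefficients are bounded by it directly (`pow_mul_norm_coeff_le`).

Both inequalities come from one operator, `Λ_u P = P_s + u z ^ s P⁽ˢ⁾` with `‖u‖ = 1`, where `P_s`
multiplies the coefficient `a_j` by `(n - j) ⋯ (n - j - s + 1)`. Arestov's inequality
`‖Λ_u P‖_p ≤ n! / (n - s)! ‖P‖_p` (`meanPow_polarCombination_le`) is averaged over `u`; at each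
point `z` of the circle the average of `‖b + u a‖ ^ p` only depends on `‖a‖` and `‖b‖` and is
bounded below elementarily, using `ρ ^ s ‖P⁽ˢ⁾‖ ≤ ‖P_s‖` in the first case, and `s = m`, where
`Λ_u` keeps just the two extreme coefficients, in the second.

Arestov's inequality is proved as follows.
* By Laguerre's theorem (`eval_polarDeriv_ne_zero`) polar derivatives with respect to points of a
  disc preserve the absence of zeros in it. Iterating them over the `s`-th roots of a number gives
  the same for `P_s + w P⁽ˢ⁾` (`eval_polarZeroIter_add_ne_zero`), hence for `Λ_u` on the unit disc;
  it also gives `ρ ^ s ‖P⁽ˢ⁾‖ ≤ ‖P_s‖`.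
* Reflecting the zeros of `P` out of the unit disc gives an outer majorant, that is, one without
  zeros in the open disc, with the same modulus on the circle. As `Λ_u` preserves domination by
  outer polynomials, and the Mahler measure of an outer polynomial is its modulus at `0`, the case
  `p = 0` follows
  (`mahlerMeasure_polarCombination_le`).
* `Λ_u` maps constants to constants. Applying the case `p = 0` to `P - a` and averaging over
  `‖a‖ = 1` turns `log` into `log⁺`, and `x ^ p` is a positive superposition of dilates of `log⁺`
  (`meanPow_le_of_posLog`).
-/

/-! ### Laguerre's theorem and iterated polar derivatives -/

/-- The polar derivative `m P + (ζ - X) P'` of `P`, viewed as a polynomial of formal degree `m`,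
with respect to the point `ζ`. The formal degree is taken in `ℂ`, so that lowering it by one needs
no truncated subtraction. -/
noncomputable def polarDeriv (m ζ : ℂ) : ℂ[X] →ₗ[ℂ] ℂ[X] :=
  m • LinearMap.id + (LinearMap.mulLeft ℂ (C ζ - X)).comp derivative

lemma polarDeriv_apply (m ζ : ℂ) (P : ℂ[X]) :
    polarDeriv m ζ P = C m * P + (C ζ - X) * derivative P := by
  simp [polarDeriv, smul_eq_C_mul]

lemma polarDeriv_eq_add (m ζ : ℂ) (P : ℂ[X]) :
    polarDeriv m ζ P = polarDeriv m 0 P + ζ • derivative P := by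
  simp only [polarDeriv_apply, smul_eq_C_mul, map_zero]; ring

lemma coeff_polarDeriv_zero (m : ℂ) (P : ℂ[X]) (j : ℕ) :
    (polarDeriv m 0 P).coeff j = (m - j) * P.coeff j := by
  rw [polarDeriv_apply]
  rcases j with _ | j
  · simp
  · simp only [map_zero, zero_sub, neg_mul, coeff_add, coeff_C_mul, coeff_neg, coeff_X_mul,
      coeff_derivative]
    push_cast; ring

lemma natDegree_polarDeriv_le {n : ℕ} (ζ : ℂ) {P : ℂ[X]} (hP : P.natDegree ≤ n + 1) :
    (polarDeriv (n + 1 : ℕ) ζ P).natDegree ≤ n := by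
  rw [natDegree_le_iff_coeff_eq_zero]
  intro j hj
  rw [polarDeriv_eq_add, coeff_add, coeff_smul, coeff_polarDeriv_zero, coeff_derivative,
    coeff_eq_zero_of_natDegree_lt (n := j + 1) (by omega)]
  rcases eq_or_lt_of_le (Nat.succ_le_of_lt hj) with h | h
  · subst h; simp
  · rw [coeff_eq_zero_of_natDegree_lt (n := j) (by omega)]; simp

/-- For `‖z‖ < ρ`, the map `r ↦ 1 / (z - r)` sends the exterior of the disc of radius `ρ`, with
`∞ ↦ 0`, onto the disc `(ρ² - ‖z‖²) ‖u‖² + 2 Re (z u) ≤ 1`. A point `u₀` outside this disc is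
strictly separated from it by the tangent functional at `u₀`. -/
lemma re_mul_le_of_quadratic_le {d : ℝ} (hd : 0 ≤ d) {z u₀ u : ℂ}
    (hu : d * ‖u‖ ^ 2 + 2 * (z * u).re ≤ 1) :
    ((d * (starRingEnd ℂ) u₀ + z) * u).re ≤ ((d * (starRingEnd ℂ) u₀ + z) * u₀).re
      - (d * ‖u₀‖ ^ 2 + 2 * (z * u₀).re - 1) / 2 := by
  have h := mul_nonneg hd (add_nonneg (sq_nonneg (u.re - u₀.re)) (sq_nonneg (u.im - u₀.im)))
  rw [← Complex.normSq_eq_norm_sq, Complex.normSq_apply] at *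
  simp at *
  nlinarith

/-- Laguerre's theorem for discs centred at the origin. -/
theorem eval_polarDeriv_ne_zero {ρ : ℝ} {n : ℕ} {P : ℂ[X]} (hdeg : P.natDegree ≤ n + 1)
    (hP : ∀ z : ℂ, ‖z‖ < ρ → P.eval z ≠ 0) {ζ : ℂ} (hζ : ‖ζ‖ < ρ) {z : ℂ} (hz : ‖z‖ < ρ) :
    (polarDeriv (n + 1 : ℕ) ζ P).eval z ≠ 0 := by
  intro h0
  have hPz := hP z hz
  set U := (P.roots.map fun r ↦ 1 / (z - r)).sum with hU
  have hder : P.derivative.eval z = P.eval z * U := by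
    rw [hU, ← (IsAlgClosed.splits P).eval_derivative_div_eval_of_ne_zero hPz]
    field_simp
  have hmain : (z - ζ) * U = (n + 1 : ℕ) := by
    rw [polarDeriv_apply] at h0
    simp only [eval_add, eval_mul, eval_C, eval_sub, eval_X, hder] at h0
    refine mul_left_cancel₀ hPz ?_
    linear_combination -h0
  have hzζ : z - ζ ≠ 0 := by
    rintro h
    rw [h, zero_mul] at hmain
    exact Nat.cast_ne_zero.2 n.succ_ne_zero hmain.symm
  set u₀ := 1 / (z - ζ) with hu₀
  have hUu : U = (n + 1 : ℕ) * u₀ := by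
    rw [hu₀, ← hmain]; field_simp
  set d := ρ ^ 2 - ‖z‖ ^ 2 with hd_def
  have hd : 0 ≤ d := by
    have := norm_nonneg z
    rw [hd_def]; nlinarith
  -- The quadratic form at `1 / (z - r)` compares with `1` as `ρ` compares with `‖r‖`.
  have key : ∀ r : ℂ, z - r ≠ 0 →
      d * ‖1 / (z - r)‖ ^ 2 + 2 * (z * (1 / (z - r))).re - 1 =
        (ρ ^ 2 - ‖r‖ ^ 2) / ‖z - r‖ ^ 2 := by
    intro r hr
    have hpos : Complex.normSq (z - r) ≠ 0 := by simpa using hr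
    rw [hd_def]
    simp only [← Complex.normSq_eq_norm_sq, one_div, map_inv₀, Complex.mul_re, Complex.inv_re,
      Complex.inv_im]
    field_simp
    simp only [Complex.normSq_apply, Complex.sub_re, Complex.sub_im]
    ring
  set δ := (d * ‖u₀‖ ^ 2 + 2 * (z * u₀).re - 1) / 2 with hδ
  have hδpos : 0 < δ := by
    rw [hδ, hu₀, key ζ hzζ]
    have h1 : 0 < ‖z - ζ‖ := norm_pos_iff.2 hzζ
    have h2 : 0 < ρ ^ 2 - ‖ζ‖ ^ 2 := by
      have := norm_nonneg ζ
      nlinarith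
    positivity
  set c := (d : ℂ) * (starRingEnd ℂ) u₀ + z
  have hroot : ∀ x ∈ P.roots.map (fun r ↦ (c * (1 / (z - r))).re), x ≤ (c * u₀).re - δ := by
    intro x hx
    obtain ⟨r, hr, rfl⟩ := Multiset.mem_map.1 hx
    have hr0 : P.eval r = 0 := (mem_roots'.1 hr).2
    have hzr : z - r ≠ 0 := by
      intro h
      rw [sub_eq_zero.1 h] at hPz
      exact hPz hr0
    have hρr : ρ ≤ ‖r‖ := by
      by_contra! h
      exact hP r h hr0
    refine re_mul_le_of_quadratic_le hd ?_
    have := key r hzr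
    have h3 : (ρ ^ 2 - ‖r‖ ^ 2) / ‖z - r‖ ^ 2 ≤ 0 := by
      apply div_nonpos_of_nonpos_of_nonneg _ (by positivity)
      have := (norm_nonneg z).trans_lt hz
      nlinarith
    linarith
  have hzero : 0 ≤ (c * u₀).re - δ := by
    have h := re_mul_le_of_quadratic_le (u := 0) (u₀ := u₀) (z := z) hd (by simp)
    rwa [mul_zero, Complex.zero_re] at h
  have hsum : (c * U).re ≤ P.roots.card * ((c * u₀).re - δ) := by
    have h := Multiset.sum_le_card_nsmul _ _ hroot
    rw [Multiset.card_map, nsmul_eq_mul] at h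
    refine le_trans (le_of_eq ?_) h
    rw [hU, ← Multiset.sum_map_mul_left]
    have := map_multiset_sum Complex.reAddGroupHom (P.roots.map fun r ↦ c * (1 / (z - r)))
    rw [Multiset.map_map] at this
    exact this
  have hcard : (P.roots.card : ℝ) ≤ (n + 1 : ℕ) := by
    exact_mod_cast (card_roots' P).trans hdeg
  have h5 : (c * U).re = (n + 1 : ℕ) * (c * u₀).re := by
    rw [hUu, mul_left_comm, ← Complex.ofReal_natCast, Complex.re_ofReal_mul]
  have h6 : (0 : ℝ) < (n + 1 : ℕ) := by positivity
  nlinarith [mul_le_mul_of_nonneg_right hcard hzero]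

/-- The composition `T_{m-s+1} ∘ ⋯ ∘ T_m`, where `T_k P = k P - X P'` is the polar derivative
at `0`. It multiplies the coefficient of `X ^ j` by `(m - j) (m - j - 1) ⋯ (m - j - s + 1)`; on
polynomials of degree at most `m` it is the `s`-th derivative conjugated by the reversals
`P ↦ X ^ m P(1 / X)` and `P ↦ X ^ (m - s) P(1 / X)`. -/
noncomputable def polarZeroIter : ℂ → ℕ → (ℂ[X] →ₗ[ℂ] ℂ[X])
  | _, 0 => LinearMap.id
  | m, s + 1 => (polarZeroIter (m - 1) s).comp (polarDeriv m 0)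

/-- Successive polar derivatives with respect to the points of a list, starting from formal
degree `m`. -/
noncomputable def polarList : ℂ → List ℂ → ℂ[X] → ℂ[X]
  | _, [], P => P
  | m, ζ :: l, P => polarList (m - 1) l (polarDeriv m ζ P)

lemma iterate_derivative_polarDeriv_zero (j : ℕ) (m : ℂ) (P : ℂ[X]) :
    derivative^[j] (polarDeriv m 0 P) = polarDeriv (m - j) 0 (derivative^[j] P) := by
  induction j generalizing m P with
  | zero => simp
  | succ j ih =>
    have h : derivative (polarDeriv m 0 P) = polarDeriv (m - 1) 0 (derivative P) := by
      simp only [polarDeriv_apply, derivative_add, derivative_mul, derivative_C, derivative_X,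
        map_zero, map_sub, map_one]
      ring
    rw [Function.iterate_succ_apply, h, ih, Function.iterate_succ_apply]
    congr 2
    push_cast; ring

lemma natDegree_list_prod_X_add_C_le (l : List ℂ) :
    ((l.map fun ζ ↦ X + C ζ).prod).natDegree ≤ l.length := by
  induction l with
  | nil => simp
  | cons ζ l ih =>
    rw [List.map_cons, List.prod_cons, List.length_cons]
    refine natDegree_mul_le.trans ?_
    rw [natDegree_X_add_C]
    omega

/-- Polar derivatives with respect to points `ζ` are the factors `T + ζ ∂`, and
`∂ T_m = T_{m-1} ∂`; so iterating them expands like the commutative product `∏ (X + ζ)`. -/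
lemma polarList_eq_sum (l : List ℂ) (m : ℂ) (P : ℂ[X]) :
    polarList m l P = ∑ k ∈ Finset.HasAntidiagonal.antidiagonal l.length,
      ((l.map fun ζ ↦ X + C ζ).prod).coeff k.1 •
        polarZeroIter (m - k.2) k.1 (derivative^[k.2] P) := by
  induction l generalizing m P with
  | nil => simp [polarList, polarZeroIter]
  | cons ζ l ih =>
    set Q := (l.map fun ζ ↦ X + C ζ).prod with hQ
    have hdeg : Q.natDegree ≤ l.length := natDegree_list_prod_X_add_C_le l
    rw [polarList, ih, List.map_cons, List.prod_cons, ← hQ, List.length_cons]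
    simp only [add_mul, coeff_add, coeff_C_mul, add_smul, Finset.sum_add_distrib]
    rw [Finset.Nat.sum_antidiagonal_succ, Finset.Nat.sum_antidiagonal_succ']
    rw [coeff_eq_zero_of_natDegree_lt (n := l.length + 1) (p := Q) (by omega)]
    simp only [coeff_X_mul_zero, zero_smul, mul_zero, zero_add, coeff_X_mul]
    rw [← Finset.sum_add_distrib]
    refine Finset.sum_congr rfl fun k _ ↦ ?_
    rw [polarDeriv_eq_add, iterate_map_add, iterate_derivative_smul,
      iterate_derivative_polarDeriv_zero, map_add, map_smul, smul_add, smul_smul,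
      mul_comm ζ, polarZeroIter, LinearMap.comp_apply, Function.iterate_succ_apply]
    congr 3
    · ring_nf
    · push_cast; ring_nf

lemma eval_polarList_ne_zero {ρ : ℝ} (l : List ℂ) {n : ℕ} {P : ℂ[X]} (hdeg : P.natDegree ≤ n)
    (hl : l.length ≤ n) (hlρ : ∀ ζ ∈ l, ‖ζ‖ < ρ) (hP : ∀ z : ℂ, ‖z‖ < ρ → P.eval z ≠ 0)
    {z : ℂ} (hz : ‖z‖ < ρ) : (polarList n l P).eval z ≠ 0 := by
  induction l generalizing n P with
  | nil => exact hP z hz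
  | cons ζ l ih =>
    obtain ⟨n, rfl⟩ : ∃ k, n = k + 1 := ⟨n - 1, by simp at hl; omega⟩
    rw [polarList]
    have : ((n + 1 : ℕ) : ℂ) - 1 = n := by push_cast; ring
    rw [this]
    refine ih (natDegree_polarDeriv_le ζ hdeg) (by simpa using hl)
      (fun x hx ↦ hlρ x (List.mem_cons_of_mem _ hx)) fun w hw ↦ ?_
    exact eval_polarDeriv_ne_zero hdeg hP (hlρ ζ List.mem_cons_self) hw

lemma exists_list_prod_eq_X_pow_add_C {s : ℕ} (hs : s ≠ 0) (w : ℂ) :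
    ∃ l : List ℂ, l.length = s ∧ (l.map fun ζ ↦ X + C ζ).prod = X ^ s + C w ∧
      ∀ ζ ∈ l, ‖ζ‖ ^ s = ‖w‖ := by
  have hmonic : (X ^ s + C w : ℂ[X]).Monic := monic_X_pow_add_C w hs
  refine ⟨(X ^ s + C w : ℂ[X]).roots.toList.map Neg.neg, ?_, ?_, ?_⟩
  · rw [List.length_map, Multiset.length_toList,
      ← (IsAlgClosed.splits (X ^ s + C w : ℂ[X])).natDegree_eq_card_roots,
      natDegree_X_pow_add_C]
  · have h := (IsAlgClosed.splits (X ^ s + C w : ℂ[X])).eq_prod_roots_of_monic hmonic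
    conv_rhs => rw [h]
    conv_rhs => rw [← Multiset.coe_toList (X ^ s + C w : ℂ[X]).roots, Multiset.map_coe,
      Multiset.prod_coe]
    rw [List.map_map]
    congr 1
    refine List.map_congr_left fun r _ ↦ ?_
    simp [sub_eq_add_neg]
  · intro ζ hζ
    obtain ⟨r, hr, rfl⟩ := List.mem_map.1 hζ
    have h := (mem_roots'.1 (Multiset.mem_toList.1 hr)).2
    simp only [IsRoot.def, eval_add, eval_pow, eval_X, eval_C] at h
    rw [norm_neg, ← norm_pow, eq_neg_of_add_eq_zero_left h, norm_neg]

/-- Polar derivatives with respect to the `s` roots of `(-ζ) ^ s = -w`: if `P` has no zero in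
`‖z‖ < ρ`, neither has the combination below of the two `s`-th order operators. -/
theorem eval_polarZeroIter_add_ne_zero {ρ : ℝ} (hρ : 0 ≤ ρ) {n s : ℕ} (hs : s ≠ 0) (hsn : s ≤ n)
    {P : ℂ[X]} (hdeg : P.natDegree ≤ n) (hP : ∀ z : ℂ, ‖z‖ < ρ → P.eval z ≠ 0)
    {w : ℂ} (hw : ‖w‖ < ρ ^ s) {z : ℂ} (hz : ‖z‖ < ρ) :
    (polarZeroIter n s P).eval z + w * (derivative^[s] P).eval z ≠ 0 := by
  obtain ⟨l, hlen, hprod, hnorm⟩ := exists_list_prod_eq_X_pow_add_C hs w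
  have h := eval_polarList_ne_zero l hdeg (hlen.trans_le hsn)
    (fun ζ hζ ↦ lt_of_pow_lt_pow_left₀ s hρ ((hnorm ζ hζ).trans_lt hw)) hP hz
  rw [polarList_eq_sum, hprod, hlen] at h
  have hsum : ∑ k ∈ Finset.HasAntidiagonal.antidiagonal s, (X ^ s + C w : ℂ[X]).coeff k.1 •
      polarZeroIter ((n : ℂ) - k.2) k.1 (derivative^[k.2] P) =
      polarZeroIter n s P + w • derivative^[s] P := by
    have hne : ((s, 0) : ℕ × ℕ) ≠ (0, s) := by simp [hs]
    rw [← Finset.sum_subset (s₁ := {(s, 0), (0, s)}), Finset.sum_pair hne]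
    · simp [coeff_X_pow, coeff_C, hs, hs.symm, polarZeroIter]
    · intro x hx
      simp at hx
      rcases hx with rfl | rfl <;> simp
    · rintro ⟨i, j⟩ hij hx
      simp at hij hx
      have hi : i ≠ s := by rintro rfl; exact hx.1 rfl (by omega)
      have hi0 : i ≠ 0 := by rintro rfl; exact hx.2 rfl (by omega)
      simp [coeff_X_pow, coeff_C, hi, hi0]
  rw [hsum] at h
  simpa using h

lemma coeff_polarZeroIter (m : ℂ) (s j : ℕ) (P : ℂ[X]) :
    (polarZeroIter m s P).coeff j = (descPochhammer ℂ s).eval (m - j) * P.coeff j := by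
  induction s generalizing m P with
  | zero => simp [polarZeroIter]
  | succ s ih =>
    rw [polarZeroIter, LinearMap.comp_apply, ih, coeff_polarDeriv_zero, descPochhammer_succ_left]
    simp only [eval_mul, eval_X, eval_comp, eval_sub, eval_one]
    ring_nf

lemma eval_zero_polarZeroIter (n s : ℕ) (P : ℂ[X]) :
    (polarZeroIter n s P).eval 0 = n.descFactorial s * P.eval 0 := by
  rw [← coeff_zero_eq_eval_zero, ← coeff_zero_eq_eval_zero, coeff_polarZeroIter]
  simp [descPochhammer_eval_eq_descFactorial]

/-- Zeros outside `‖z‖ < ρ` make the `s`-th derivative smaller, by the factor `ρ ^ s`, than its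
reciprocal counterpart on the closed disc. -/
theorem pow_mul_norm_iterate_derivative_le {ρ : ℝ} (hρ : 0 < ρ) {n s : ℕ} (hs : s ≠ 0)
    (hsn : s ≤ n) {P : ℂ[X]} (hdeg : P.natDegree ≤ n)
    (hP : ∀ z : ℂ, ‖z‖ < ρ → P.eval z ≠ 0) {z : ℂ} (hz : ‖z‖ ≤ ρ) :
    ρ ^ s * ‖(derivative^[s] P).eval z‖ ≤ ‖(polarZeroIter n s P).eval z‖ := by
  have hclosed : IsClosed {z : ℂ | ρ ^ s * ‖(derivative^[s] P).eval z‖ ≤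
      ‖(polarZeroIter n s P).eval z‖} :=
    isClosed_le (continuous_const.mul (Polynomial.continuous _).norm)
      (Polynomial.continuous _).norm
  have hsub : Metric.ball (0 : ℂ) ρ ⊆ {z : ℂ | ρ ^ s * ‖(derivative^[s] P).eval z‖ ≤
      ‖(polarZeroIter n s P).eval z‖} := by
    intro z hz
    rw [mem_ball_zero_iff] at hz
    by_contra h
    rw [Set.mem_ofPred_eq, not_le] at h
    have hD : 0 < ‖(derivative^[s] P).eval z‖ := by
      by_contra! hD
      rw [le_antisymm hD (norm_nonneg _), mul_zero] at h
      exact (norm_nonneg _).not_gt h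
    refine eval_polarZeroIter_add_ne_zero hρ.le hs hsn hdeg hP (z := z)
      (w := -(polarZeroIter n s P).eval z / (derivative^[s] P).eval z) ?_ hz ?_
    · rw [norm_div, norm_neg, div_lt_iff₀ hD]
      exact h
    · rw [div_mul_cancel₀ _ (norm_pos_iff.1 hD), add_neg_cancel]
  have := closure_minimal hsub hclosed
  rw [closure_ball _ hρ.ne'] at this
  exact this (mem_closedBall_zero_iff.2 hz)

/-! ### Mahler measure: an inequality of de Bruijn and Springer -/

/-- The operator `P ↦ T_{n-s+1} ⋯ T_n P + u X ^ s P⁽ˢ⁾`, which multiplies the coefficient of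
`X ^ j` by `(n - j) ⋯ (n - j - s + 1) + u j (j - 1) ⋯ (j - s + 1)`. -/
noncomputable def polarCombination (n s : ℕ) (u : ℂ) : ℂ[X] →ₗ[ℂ] ℂ[X] :=
  polarZeroIter n s + u • (LinearMap.mulLeft ℂ (X ^ s)).comp (derivative ^ s)

lemma eval_polarCombination (n s : ℕ) (u z : ℂ) (P : ℂ[X]) :
    (polarCombination n s u P).eval z =
      (polarZeroIter n s P).eval z + u * (z ^ s * (derivative^[s] P).eval z) := by
  simp [polarCombination, Module.End.pow_apply]

lemma polarCombination_C {n s : ℕ} (hs : s ≠ 0) (u a : ℂ) :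
    polarCombination n s u (C a) = C (n.descFactorial s * a) := by
  have h : polarZeroIter n s (C a) = C (n.descFactorial s * a) := by
    ext j
    rw [coeff_polarZeroIter, coeff_C, coeff_C]
    split_ifs with hj
    · rw [hj, Nat.cast_zero, sub_zero, descPochhammer_eval_eq_descFactorial]
    · rw [mul_zero]
  simp [polarCombination, Module.End.pow_apply, h, iterate_derivative_C (Nat.pos_of_ne_zero hs)]

lemma eval_zero_polarCombination {n s : ℕ} (hs : s ≠ 0) (u : ℂ) (P : ℂ[X]) :
    (polarCombination n s u P).eval 0 = n.descFactorial s * P.eval 0 := by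
  rw [eval_polarCombination, eval_zero_polarZeroIter, zero_pow hs]
  simp

lemma eval_polarCombination_ne_zero {n s : ℕ} (hs : s ≠ 0) (hsn : s ≤ n) {u : ℂ} (hu : ‖u‖ ≤ 1)
    {P : ℂ[X]} (hdeg : P.natDegree ≤ n) (hP : ∀ z : ℂ, ‖z‖ < 1 → P.eval z ≠ 0)
    {z : ℂ} (hz : ‖z‖ < 1) : (polarCombination n s u P).eval z ≠ 0 := by
  rw [eval_polarCombination, ← mul_assoc]
  refine eval_polarZeroIter_add_ne_zero zero_le_one hs hsn hdeg hP ?_ hz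
  rw [norm_mul, norm_pow, one_pow]
  calc ‖u‖ * ‖z‖ ^ s ≤ 1 * ‖z‖ ^ s := by gcongr
    _ < 1 := by rw [one_mul]; exact pow_lt_one₀ (norm_nonneg _) hz hs

lemma mahlerMeasure_eq_norm_eval_zero {P : ℂ[X]} (hP : ∀ z : ℂ, ‖z‖ < 1 → P.eval z ≠ 0) :
    P.mahlerMeasure = ‖P.eval 0‖ := by
  rw [mahlerMeasure_eq_leadingCoeff_mul_prod_roots]
  conv_rhs => rw [(IsAlgClosed.splits P).eq_prod_roots]
  rw [eval_mul, eval_C, norm_mul, eval_multiset_prod, Multiset.map_map,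
    ← coe_nnnorm (Multiset.prod _)]
  congr 1
  have h1 : ∀ r ∈ P.roots, max 1 ‖r‖ = ‖(eval 0 ∘ fun a : ℂ ↦ X - C a) r‖ := by
    intro r hr
    have : 1 ≤ ‖r‖ := by
      by_contra! h
      exact hP r h (mem_roots'.1 hr).2
    simpa using this
  rw [Multiset.map_congr rfl h1, coe_nnnorm]
  exact (Multiset.prod_hom' _ (normHom : ℂ →*₀ ℝ) _)

lemma mahlerMeasure_mono {F R : ℂ[X]} (h : ∀ z : ℂ, ‖z‖ = 1 → ‖F.eval z‖ ≤ ‖R.eval z‖) :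
    F.mahlerMeasure ≤ R.mahlerMeasure := by
  by_cases hF : F = 0
  · rw [hF, mahlerMeasure_zero]
    exact mahlerMeasure_nonneg R
  have hzero : ((circleMap 0 1) ⁻¹' (F.rootSet ℂ)).Countable :=
    (F.rootSet_finite ℂ).countable.preimage_circleMap 0 one_ne_zero
  have hae : ∀ᵐ θ : ℝ, F.eval (circleMap 0 1 θ) ≠ 0 := by
    filter_upwards [hzero.ae_notMem MeasureTheory.volume] with θ hθ h0
    exact hθ (by simp [mem_rootSet, hF, h0])
  have hR : R ≠ 0 := by
    rintro rfl
    obtain ⟨θ, hθ⟩ := hae.exists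
    have := h (circleMap 0 1 θ) (by simp)
    simp only [eval_zero, norm_zero, norm_le_zero_iff] at this
    exact hθ this
  rw [mahlerMeasure_def_of_ne_zero hF, mahlerMeasure_def_of_ne_zero hR, Real.exp_le_exp]
  gcongr
  refine intervalIntegral.integral_mono_ae Real.two_pi_pos.le F.intervalIntegrable_mahlerMeasure
    R.intervalIntegrable_mahlerMeasure ?_
  filter_upwards [hae] with θ hθ
  exact Real.log_le_log (norm_pos_iff.2 hθ) (h _ (by simp))

/-- Replacing every zero inside the unit disc by its reflection gives an outer majorant. -/
lemma exists_outer_majorant_of_roots (S : Multiset ℂ) :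
    ∃ R : ℂ[X], R.natDegree ≤ S.card ∧ (∀ z : ℂ, ‖z‖ < 1 → R.eval z ≠ 0) ∧
      (∀ z : ℂ, ‖z‖ ≤ 1 → ‖((S.map fun r ↦ X - C r).prod).eval z‖ ≤ ‖R.eval z‖) ∧
      ‖R.eval 0‖ = (S.map fun r ↦ max 1 ‖r‖).prod := by
  induction S using Multiset.induction_on with
  | empty => exact ⟨1, by simp⟩
  | cons r S ih =>
    obtain ⟨R, hdeg, hne, hle, h0⟩ := ih
    rcases le_or_gt 1 ‖r‖ with hr | hr
    · refine ⟨(X - C r) * R, ?_, ?_, ?_, ?_⟩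
      · refine natDegree_mul_le.trans ?_
        rw [natDegree_X_sub_C, Multiset.card_cons]
        omega
      · intro z hz
        rw [eval_mul]
        refine mul_ne_zero ?_ (hne z hz)
        rw [eval_sub, eval_X, eval_C, sub_ne_zero]
        rintro rfl
        exact hz.not_ge hr
      · intro z hz
        rw [Multiset.map_cons, Multiset.prod_cons, eval_mul, eval_mul, norm_mul, norm_mul]
        gcongr
        exact hle z hz
      · rw [Multiset.map_cons, Multiset.prod_cons, eval_mul, norm_mul, h0, max_eq_right hr]
        simp
    · refine ⟨(1 - C ((starRingEnd ℂ) r) * X) * R, ?_, ?_, ?_, ?_⟩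
      · refine natDegree_mul_le.trans ?_
        have : (1 - C ((starRingEnd ℂ) r) * X).natDegree ≤ 1 := by compute_degree
        rw [Multiset.card_cons]
        omega
      · intro z hz
        rw [eval_mul]
        refine mul_ne_zero ?_ (hne z hz)
        simp only [eval_sub, eval_one, eval_mul, eval_C, eval_X]
        intro h
        have h1 : ‖(starRingEnd ℂ) r * z‖ = 1 := by
          rw [← sub_eq_zero.1 h, norm_one]
        rw [norm_mul, RCLike.norm_conj] at h1
        nlinarith [norm_nonneg z, norm_nonneg r]
      · intro z hz
        rw [Multiset.map_cons, Multiset.prod_cons, eval_mul, eval_mul, norm_mul, norm_mul]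
        refine mul_le_mul ?_ (hle z hz) (norm_nonneg _) (norm_nonneg _)
        simp only [eval_sub, eval_one, eval_mul, eval_C, eval_X]
        refine le_of_sq_le_sq ?_ (norm_nonneg _)
        have h1 : ‖1 - (starRingEnd ℂ) r * z‖ ^ 2 - ‖z - r‖ ^ 2 =
            (1 - ‖z‖ ^ 2) * (1 - ‖r‖ ^ 2) := by
          simp only [← Complex.normSq_eq_norm_sq, Complex.normSq_apply]
          simp
          ring
        have h2 : 0 ≤ (1 - ‖z‖ ^ 2) * (1 - ‖r‖ ^ 2) := by
          apply mul_nonneg <;> nlinarith [norm_nonneg z, norm_nonneg r]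
        linarith
      · rw [Multiset.map_cons, Multiset.prod_cons, eval_mul, norm_mul, h0, max_eq_left hr.le]
        simp

lemma exists_outer_majorant (P : ℂ[X]) (hP : P ≠ 0) :
    ∃ R : ℂ[X], R.natDegree ≤ P.natDegree ∧ (∀ z : ℂ, ‖z‖ < 1 → R.eval z ≠ 0) ∧
      (∀ z : ℂ, ‖z‖ ≤ 1 → ‖P.eval z‖ ≤ ‖R.eval z‖) ∧ ‖R.eval 0‖ = P.mahlerMeasure := by
  obtain ⟨R, hdeg, hne, hle, h0⟩ := exists_outer_majorant_of_roots P.roots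
  have hlc : P.leadingCoeff ≠ 0 := leadingCoeff_ne_zero.2 hP
  refine ⟨C P.leadingCoeff * R, ?_, ?_, ?_, ?_⟩
  · exact (natDegree_C_mul_le _ _).trans (hdeg.trans (card_roots' P))
  · intro z hz
    rw [eval_mul, eval_C]
    exact mul_ne_zero hlc (hne z hz)
  · intro z hz
    conv_lhs => rw [(IsAlgClosed.splits P).eq_prod_roots]
    rw [eval_mul, eval_mul, norm_mul, norm_mul]
    gcongr
    exact hle z hz
  · rw [eval_mul, eval_C, norm_mul, h0, mahlerMeasure_eq_leadingCoeff_mul_prod_roots]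

/-- If `R` is outer and dominates `P` in the disc, then `R + l P` is outer for `‖l‖ < 1`; as the
operator preserves outer polynomials, it preserves the domination. -/
lemma norm_eval_polarCombination_le {n s : ℕ} (hs : s ≠ 0) (hsn : s ≤ n) {u : ℂ} (hu : ‖u‖ ≤ 1)
    {P R : ℂ[X]} (hP : P.natDegree ≤ n) (hR : R.natDegree ≤ n)
    (hne : ∀ z : ℂ, ‖z‖ < 1 → R.eval z ≠ 0)
    (hle : ∀ z : ℂ, ‖z‖ ≤ 1 → ‖P.eval z‖ ≤ ‖R.eval z‖) {z : ℂ} (hz : ‖z‖ ≤ 1) :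
    ‖(polarCombination n s u P).eval z‖ ≤ ‖(polarCombination n s u R).eval z‖ := by
  have hclosed : IsClosed {z : ℂ | ‖(polarCombination n s u P).eval z‖ ≤
      ‖(polarCombination n s u R).eval z‖} :=
    isClosed_le (Polynomial.continuous _).norm (Polynomial.continuous _).norm
  have hsub : Metric.ball (0 : ℂ) 1 ⊆ {z : ℂ | ‖(polarCombination n s u P).eval z‖ ≤
      ‖(polarCombination n s u R).eval z‖} := by
    intro z hz
    rw [mem_ball_zero_iff] at hz
    by_contra h
    rw [Set.mem_ofPred_eq, not_le] at h
    have hD : 0 < ‖(polarCombination n s u P).eval z‖ := (norm_nonneg _).trans_lt h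
    set l := -(polarCombination n s u R).eval z / (polarCombination n s u P).eval z with hl
    have hl1 : ‖l‖ < 1 := by
      rw [hl, norm_div, norm_neg, div_lt_one hD]
      exact h
    refine eval_polarCombination_ne_zero hs hsn hu (P := R + l • P) (z := z) ?_ ?_ hz ?_
    · exact natDegree_add_le_of_degree_le hR ((natDegree_smul_le _ _).trans hP)
    · intro w hw h0
      rw [eval_add, eval_smul, smul_eq_mul] at h0
      have h1 : ‖R.eval w‖ = ‖l‖ * ‖P.eval w‖ := by
        rw [eq_neg_of_add_eq_zero_left h0, norm_neg, norm_mul]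
      have h2 : 0 < ‖R.eval w‖ := norm_pos_iff.2 (hne w hw)
      have h3 := mul_le_mul_of_nonneg_left (hle w hw.le) (norm_nonneg l)
      nlinarith
    · rw [map_add, map_smul, eval_add, eval_smul, smul_eq_mul, hl,
        div_mul_cancel₀ _ (norm_pos_iff.1 hD), add_neg_cancel]
  have := closure_minimal hsub hclosed
  rw [closure_ball _ one_ne_zero] at this
  exact this (mem_closedBall_zero_iff.2 hz)

/-- The inequality of de Bruijn and Springer for `polarCombination`. -/
theorem mahlerMeasure_polarCombination_le {n s : ℕ} (hs : s ≠ 0) (hsn : s ≤ n) {u : ℂ}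
    (hu : ‖u‖ ≤ 1) {P : ℂ[X]} (hP : P.natDegree ≤ n) :
    (polarCombination n s u P).mahlerMeasure ≤ n.descFactorial s * P.mahlerMeasure := by
  by_cases h0 : P = 0
  · simp [h0]
  obtain ⟨R, hdeg, hne, hle, hR0⟩ := exists_outer_majorant P h0
  calc (polarCombination n s u P).mahlerMeasure
      ≤ (polarCombination n s u R).mahlerMeasure := mahlerMeasure_mono fun z hz ↦
        norm_eval_polarCombination_le hs hsn hu hP (hdeg.trans hP) hne hle hz.le
    _ = n.descFactorial s * P.mahlerMeasure := by
      rw [mahlerMeasure_eq_norm_eval_zero fun z hz ↦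
        eval_polarCombination_ne_zero hs hsn hu (hdeg.trans hP) hne hz,
        eval_zero_polarCombination hs, norm_mul, hR0, Complex.norm_natCast]

/-! ### From the Mahler measure to `p`-th means -/

/-- The mean of `‖P‖ ^ p` over the unit circle. -/
noncomputable def meanPow (p : ℝ) (P : ℂ[X]) : ℝ :=
  Real.circleAverage (fun z ↦ ‖P.eval z‖ ^ p) 0 1

lemma meanPow_nonneg (p : ℝ) (P : ℂ[X]) : 0 ≤ meanPow p P :=
  Real.circleAverage_nonneg_of_nonneg fun _ _ ↦ by positivity

lemma circleNorm_eq_meanPow {p : ℝ} (hp : p ≠ 0) (P : ℂ[X]) :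
    circleNorm p P = meanPow p P ^ (1 / p) := by
  rw [circleNorm, if_neg hp, meanPow, Real.circleAverage_def]
  simp [circleMap_zero]

lemma continuous_norm_eval_rpow {p : ℝ} (hp : 0 ≤ p) (P : ℂ[X]) :
    Continuous fun z : ℂ ↦ ‖P.eval z‖ ^ p :=
  (P.continuous.norm).rpow_const fun _ ↦ Or.inr hp

/-- Averaging `log ‖F - a‖` over `‖a‖ = 1` gives `log⁺ ‖F‖`. As `polarCombination` sends constants
to constants, the Mahler measure inequality for `P - a` yields one for `log⁺`. -/
lemma circleAverage_posLog_polarCombination_le {n s : ℕ} (hs : s ≠ 0) (hsn : s ≤ n) {u : ℂ}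
    (hu : ‖u‖ ≤ 1) {P : ℂ[X]} (hP : P.natDegree ≤ n) :
    Real.circleAverage
        (fun z ↦ Real.posLog ‖((n.descFactorial s : ℂ)⁻¹ • polarCombination n s u P).eval z‖) 0 1 ≤
      Real.circleAverage (fun z ↦ Real.posLog ‖P.eval z‖) 0 1 := by
  set c : ℂ := (n.descFactorial s : ℂ) with hc
  have hc0' : 0 < n.descFactorial s := Nat.descFactorial_pos.2 hsn
  have hc0 : c ≠ 0 := Nat.cast_ne_zero.2 hc0'.ne'
  set F := c⁻¹ • polarCombination n s u P with hF
  have hmer : ∀ Q : ℂ[X], Meromorphic fun z ↦ Q.eval z := fun Q ↦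
    fun z ↦ (analyticOnNhd_id.aeval_polynomial Q z (Set.mem_univ z)).meromorphicAt
  have havg : ∀ Q : ℂ[X], Real.circleAverage (fun z ↦ Real.posLog ‖Q.eval z‖) 0 1 =
      (2 * Real.pi)⁻¹ * ∫ α in (0 : ℝ)..(2 * Real.pi),
        (Q - C (circleMap 0 1 α)).logMahlerMeasure := by
    intro Q
    have h := congrFun (ValueDistribution.circleAverage_circleAverage_eq_proximity_top (hmer Q)) 1
    rw [ValueDistribution.proximity_top] at h
    rw [← h, Real.circleAverage_def, smul_eq_mul]
    simp [logMahlerMeasure_def]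
  have hint : ∀ Q : ℂ[X], IntervalIntegrable
      (fun α ↦ (Q - C (circleMap 0 1 α)).logMahlerMeasure) MeasureTheory.volume
      0 (2 * Real.pi) := by
    intro Q
    have h := ValueDistribution.circleIntegrable_circleAverage_log_norm_sub (R := 1) (hmer Q)
    rw [circleIntegrable_def] at h
    simpa [logMahlerMeasure_def] using h
  rw [havg, havg]
  gcongr
  refine intervalIntegral.integral_mono_ae Real.two_pi_pos.le (hint F) (hint P) ?_
  have hcount : ((circleMap 0 1) ⁻¹' {F.coeff 0}).Countable :=
    (Set.countable_singleton _).preimage_circleMap 0 one_ne_zero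
  filter_upwards [hcount.ae_notMem MeasureTheory.volume] with α hα
  set a := circleMap 0 1 α
  have hFa : F - C a ≠ 0 := by
    intro h
    apply hα
    simp [sub_eq_zero.1 h, a]
  have hmap : polarCombination n s u (P - C a) = C c * (F - C a) := by
    rw [map_sub, polarCombination_C hs, mul_sub, ← smul_eq_C_mul, hF, smul_smul,
      mul_inv_cancel₀ hc0, one_smul, C_mul]
  have hPa : P - C a ≠ 0 := by
    intro h
    rw [h, map_zero, eq_comm, mul_eq_zero] at hmap
    exact hmap.elim (C_ne_zero.2 hc0) hFa
  have hmain := mahlerMeasure_polarCombination_le hs hsn hu (P := P - C a) (by simpa using hP)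
  rw [hmap, mahlerMeasure_mul, mahlerMeasure_const, hc, Complex.norm_natCast] at hmain
  have hmain' := le_of_mul_le_mul_left hmain (Nat.cast_pos.2 hc0')
  simp only [logMahlerMeasure_eq_log_MahlerMeasure]
  exact Real.log_le_log (mahlerMeasure_pos_of_ne_zero hFa) hmain'

/-- `x ^ p` is, up to a constant, a superposition of the functions `log⁺ (e ^ (-τ) x)` with
positive weights `e ^ (p τ)`. -/
lemma lintegral_posLog_mul_exp {p : ℝ} (hp : 0 < p) {x : ℝ} (hx : 0 ≤ x) :
    ∫⁻ τ : ℝ, ENNReal.ofReal (Real.posLog (Real.exp (-τ) * x)) * ENNReal.ofReal (Real.exp (p * τ)) =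
      ENNReal.ofReal (x ^ p) * ∫⁻ y : ℝ, ENNReal.ofReal (max y 0 * Real.exp (-(p * y))) := by
  rcases hx.eq_or_lt with rfl | hx
  · simp [Real.zero_rpow hp.ne']
  rw [← MeasureTheory.lintegral_const_mul _ (by fun_prop),
    ← MeasureTheory.lintegral_sub_left_eq_self _ (Real.log x)]
  refine MeasureTheory.lintegral_congr fun y ↦ ?_
  rw [← ENNReal.ofReal_mul Real.posLog_nonneg, ← ENNReal.ofReal_mul (by positivity)]
  congr 1
  have h1 : Real.exp (-(Real.log x - y)) * x = Real.exp y := by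
    rw [neg_sub, Real.exp_sub, Real.exp_log hx, div_mul_cancel₀ _ hx.ne']
  rw [h1, Real.posLog_apply, Real.log_exp, max_comm, Real.rpow_def_of_pos hx, mul_left_comm,
    ← Real.exp_add]
  congr 2
  ring

lemma lintegral_max_mul_exp {p : ℝ} (hp : 0 < p) :
    ∫⁻ y : ℝ, ENNReal.ofReal (max y 0 * Real.exp (-(p * y))) =
      ENNReal.ofReal ((1 / p) ^ (2 : ℝ) * Real.Gamma 2) := by
  have hval := Real.integral_rpow_mul_exp_neg_mul_Ioi two_pos hp
  have hint : MeasureTheory.IntegrableOn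
      (fun t : ℝ ↦ t ^ ((2 : ℝ) - 1) * Real.exp (-(p * t))) (Set.Ioi 0) := by
    refine MeasureTheory.Integrable.of_integral_ne_zero ?_
    rw [hval]
    have := Real.Gamma_pos_of_pos two_pos
    positivity
  rw [← hval, MeasureTheory.ofReal_integral_eq_lintegral_ofReal hint,
    ← MeasureTheory.lintegral_indicator measurableSet_Ioi]
  · refine MeasureTheory.lintegral_congr fun y ↦ ?_
    rcases le_or_gt y 0 with hy | hy
    · rw [Set.indicator_of_notMem (by simpa using hy), max_eq_right hy]
      simp
    · rw [Set.indicator_of_mem (by simpa using hy), max_eq_left hy.le]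
      norm_num
  · filter_upwards [MeasureTheory.ae_restrict_mem measurableSet_Ioi] with t ht
    have : 0 < t := ht
    positivity

lemma ofReal_circleAverage {f : ℂ → ℝ} (hf : Continuous f) (h0 : ∀ z, 0 ≤ f z) :
    ENNReal.ofReal (Real.circleAverage f 0 1) = ENNReal.ofReal (2 * Real.pi)⁻¹ *
      ∫⁻ θ in Set.Ioc 0 (2 * Real.pi), ENNReal.ofReal (f (circleMap 0 1 θ)) := by
  rw [Real.circleAverage_def, smul_eq_mul, ENNReal.ofReal_mul (by positivity),
    intervalIntegral.integral_of_le Real.two_pi_pos.le,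
    MeasureTheory.ofReal_integral_eq_lintegral_ofReal]
  · exact (hf.comp (continuous_circleMap 0 1)).integrableOn_Ioc
  · exact Filter.Eventually.of_forall fun θ ↦ h0 _

/-- Domination of all `log⁺`-means implies domination of `p`-th means. -/
lemma meanPow_le_of_posLog {F P : ℂ[X]}
    (h : ∀ t : ℝ, Real.circleAverage (fun z ↦ Real.posLog (Real.exp (-t) * ‖F.eval z‖)) 0 1 ≤
      Real.circleAverage (fun z ↦ Real.posLog (Real.exp (-t) * ‖P.eval z‖)) 0 1)
    {p : ℝ} (hp : 0 < p) : meanPow p F ≤ meanPow p P := by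
  set K := ∫⁻ y : ℝ, ENNReal.ofReal (max y 0 * Real.exp (-(p * y))) with hK
  have hKpos : K ≠ 0 := by
    rw [hK, lintegral_max_mul_exp hp]
    have := Real.Gamma_pos_of_pos two_pos
    exact (ENNReal.ofReal_pos.2 (by positivity)).ne'
  have hKtop : K ≠ ⊤ := by
    rw [hK, lintegral_max_mul_exp hp]
    exact ENNReal.ofReal_ne_top
  have hcont : ∀ (t : ℝ) (Q : ℂ[X]),
      Continuous fun z ↦ Real.posLog (Real.exp (-t) * ‖Q.eval z‖) := fun t Q ↦
    Real.continuous_posLog.comp (continuous_const.mul Q.continuous.norm)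
  have hrep : ∀ Q : ℂ[X], ENNReal.ofReal (meanPow p Q) * K = ∫⁻ t : ℝ,
      ENNReal.ofReal (Real.circleAverage
        (fun z ↦ Real.posLog (Real.exp (-t) * ‖Q.eval z‖)) 0 1) *
      ENNReal.ofReal (Real.exp (p * t)) := by
    intro Q
    have hm : Measurable fun x : ℝ × ℝ ↦
        ENNReal.ofReal (Real.posLog (Real.exp (-x.1) * ‖Q.eval (circleMap 0 1 x.2)‖)) := by
      refine (Continuous.measurable ?_).ennreal_ofReal
      refine Real.continuous_posLog.comp (Continuous.mul (by fun_prop) ?_)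
      exact (Q.continuous.comp ((continuous_circleMap 0 1).comp continuous_snd)).norm
    rw [meanPow, ofReal_circleAverage (continuous_norm_eval_rpow hp.le Q)
      (fun z ↦ by positivity), mul_assoc]
    simp only [ofReal_circleAverage (hcont _ Q) fun _ ↦ Real.posLog_nonneg, mul_assoc]
    rw [MeasureTheory.lintegral_const_mul', ← MeasureTheory.lintegral_mul_const' _ _ hKtop]
    · congr 1
      simp only [hK, ← lintegral_posLog_mul_exp hp (norm_nonneg _)]
      rw [MeasureTheory.lintegral_lintegral_swap]
      · refine MeasureTheory.lintegral_congr fun t ↦ ?_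
        rw [MeasureTheory.lintegral_mul_const' _ _ ENNReal.ofReal_ne_top]
      · have hexp : Measurable fun x : ℝ × ℝ ↦ ENNReal.ofReal (Real.exp (p * x.2)) := by fun_prop
        exact ((hm.comp measurable_swap).mul hexp).aemeasurable
    · exact ENNReal.ofReal_ne_top
  have hle : ENNReal.ofReal (meanPow p F) * K ≤ ENNReal.ofReal (meanPow p P) * K := by
    rw [hrep, hrep]
    refine MeasureTheory.lintegral_mono fun t ↦ ?_
    exact mul_le_mul_left (ENNReal.ofReal_le_ofReal (h t)) _
  exact (ENNReal.ofReal_le_ofReal_iff (meanPow_nonneg p P)).1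
    ((ENNReal.mul_le_mul_iff_left hKpos hKtop).1 hle)

lemma meanPow_smul (p : ℝ) (c : ℂ) (P : ℂ[X]) : meanPow p (c • P) = ‖c‖ ^ p * meanPow p P := by
  rw [meanPow, meanPow, ← smul_eq_mul, ← Real.circleAverage_fun_smul]
  congr 1
  ext z
  rw [eval_smul, smul_eq_mul, norm_mul, Real.mul_rpow (norm_nonneg _) (norm_nonneg _), smul_eq_mul]

/-- Arestov's inequality for `polarCombination`. -/
theorem meanPow_polarCombination_le {n s : ℕ} (hs : s ≠ 0) (hsn : s ≤ n) {u : ℂ}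
    (hu : ‖u‖ ≤ 1) {P : ℂ[X]} (hP : P.natDegree ≤ n) {p : ℝ} (hp : 0 < p) :
    meanPow p (polarCombination n s u P) ≤ (n.descFactorial s : ℝ) ^ p * meanPow p P := by
  set c : ℂ := (n.descFactorial s : ℂ) with hc
  have hc0 : c ≠ 0 := Nat.cast_ne_zero.2 (Nat.descFactorial_pos.2 hsn).ne'
  have h : meanPow p (c⁻¹ • polarCombination n s u P) ≤ meanPow p P := by
    refine meanPow_le_of_posLog (fun t ↦ ?_) hp
    have h := circleAverage_posLog_polarCombination_le hs hsn hu
      (P := (Real.exp (-t) : ℂ) • P) ((natDegree_smul_le _ _).trans hP)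
    have hnorm : ∀ (Q : ℂ[X]) (z : ℂ),
        ‖((Real.exp (-t) : ℂ) • Q).eval z‖ = Real.exp (-t) * ‖Q.eval z‖ := fun Q z ↦ by
      rw [eval_smul, smul_eq_mul, norm_mul, Complex.norm_real, Real.norm_eq_abs, Real.abs_exp]
    simpa only [map_smul, smul_comm _ (Real.exp (-t) : ℂ), hnorm] using h
  have h2 : polarCombination n s u P = c • (c⁻¹ • polarCombination n s u P) := by
    rw [smul_smul, mul_inv_cancel₀ hc0, one_smul]
  rw [h2, meanPow_smul, hc, Complex.norm_natCast]
  gcongr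

/-! ### Averaging over the unimodular parameter -/

lemma circleAverage_circleAverage_swap {f : ℂ → ℂ → ℝ} (hf : Continuous (Function.uncurry f)) :
    Real.circleAverage (fun z ↦ Real.circleAverage (fun u ↦ f z u) 0 1) 0 1 =
      Real.circleAverage (fun u ↦ Real.circleAverage (fun z ↦ f z u) 0 1) 0 1 := by
  simp only [Real.circleAverage_def, smul_eq_mul, intervalIntegral.integral_const_mul]
  congr 2
  refine MeasureTheory.intervalIntegral_intervalIntegral_swap
    (F := fun x y ↦ f (circleMap 0 1 x) (circleMap 0 1 y)) ?_
  have hc : Continuous (Function.uncurry fun x y ↦ f (circleMap 0 1 x) (circleMap 0 1 y)) :=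
    hf.comp (((continuous_circleMap 0 1).comp continuous_fst).prodMk
      ((continuous_circleMap 0 1).comp continuous_snd))
  exact (hc.continuousOn.integrableOn_compact (isCompact_uIcc.prod isCompact_uIcc)).mono_set
    (Set.prod_mono Set.uIoc_subset_uIcc Set.uIoc_subset_uIcc)

lemma continuous_circleAverage_of_continuous {f : ℂ → ℂ → ℝ}
    (hf : Continuous (Function.uncurry f)) :
    Continuous fun z ↦ Real.circleAverage (fun u ↦ f z u) 0 1 := by
  simp only [Real.circleAverage_def, smul_eq_mul]
  refine continuous_const.mul
    (intervalIntegral.continuous_parametric_intervalIntegral_of_continuous' ?_ _ _)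
  exact hf.comp (continuous_fst.prodMk ((continuous_circleMap 0 1).comp continuous_snd))

lemma continuous_norm_add_mul_rpow {p : ℝ} (hp : 0 ≤ p) {A B : ℂ → ℂ} (hA : Continuous A)
    (hB : Continuous B) :
    Continuous (Function.uncurry fun z u : ℂ ↦ ‖A z + u * B z‖ ^ p) := by
  refine Continuous.rpow_const (Continuous.norm ?_) fun _ ↦ Or.inr hp
  exact (hA.comp continuous_fst).add (continuous_snd.mul (hB.comp continuous_fst))

/-- The mean of `‖b + u a‖ ^ p` over `‖u‖ = 1` depends on the moduli of `a` and `b` only. -/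
lemma circleAverage_norm_add_mul_rpow (p : ℝ) (a b : ℂ) :
    Real.circleAverage (fun u ↦ ‖b + u * a‖ ^ p) 0 1 =
      Real.circleAverage (fun u ↦ ‖(‖b‖ : ℂ) + u * ‖a‖‖ ^ p) 0 1 := by
  rw [Real.circleAverage_eq_integral_add (b.arg - a.arg), Real.circleAverage_def]
  congr 2
  ext θ
  have h : b + circleMap 0 1 (θ + (b.arg - a.arg)) * a =
      ((‖b‖ : ℂ) + circleMap 0 1 θ * ‖a‖) * Complex.exp (b.arg * Complex.I) := by
    have he : Complex.exp ((θ + (b.arg - a.arg) : ℝ) * Complex.I) *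
        Complex.exp (a.arg * Complex.I) =
        Complex.exp (θ * Complex.I) * Complex.exp (b.arg * Complex.I) := by
      rw [← Complex.exp_add, ← Complex.exp_add]
      congr 1
      push_cast; ring
    simp only [circleMap_zero, Complex.ofReal_one, one_mul]
    linear_combination -Complex.norm_mul_exp_arg_mul_I b -
      Complex.exp ((θ + (b.arg - a.arg) : ℝ) * Complex.I) * Complex.norm_mul_exp_arg_mul_I a +
      ‖a‖ * he
  rw [h, norm_mul, Complex.norm_exp_ofReal_mul_I, mul_one]

lemma rpow_mul_meanPow_le {p : ℝ} (hp : 0 ≤ p) {a b : ℂ} {k r : ℝ} (hk : 0 ≤ k)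
    (h : ∀ u : ℂ, ‖u‖ = 1 → k * ‖(r : ℂ) + u‖ ≤ ‖(‖b‖ : ℂ) + u * ‖a‖‖) :
    k ^ p * meanPow p (C (r : ℂ) + X) ≤ Real.circleAverage (fun u ↦ ‖b + u * a‖ ^ p) 0 1 := by
  rw [circleAverage_norm_add_mul_rpow, meanPow, ← smul_eq_mul, ← Real.circleAverage_fun_smul]
  refine Real.circleAverage_mono ?_ ?_ fun u hu ↦ ?_
  · exact ((continuous_norm_eval_rpow hp _).const_smul (_ : ℝ)).continuousOn.circleIntegrable'
  · refine ContinuousOn.circleIntegrable' (Continuous.continuousOn ?_)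
    exact ((continuous_const.add (continuous_id.mul continuous_const)).norm).rpow_const
      fun _ ↦ Or.inr hp
  · have hu1 : ‖u‖ = 1 := by simpa using hu
    rw [smul_eq_mul, ← Real.mul_rpow hk (norm_nonneg _)]
    refine Real.rpow_le_rpow (by positivity) ?_ hp
    simpa using h u hu1

lemma mul_norm_add_le_of_mul_le {x y r : ℝ} (hx : 0 ≤ x) (hr : 1 ≤ r) (hxy : r * x ≤ y) {u : ℂ}
    (hu : ‖u‖ = 1) : x * ‖(r : ℂ) + u‖ ≤ ‖(y : ℂ) + u * x‖ := by
  refine le_of_sq_le_sq ?_ (norm_nonneg _)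
  have hu2 : u.re * u.re + u.im * u.im = 1 := by
    rw [← Complex.normSq_apply, Complex.normSq_eq_norm_sq, hu, one_pow]
  have hre : -1 ≤ u.re := by nlinarith [mul_self_nonneg u.im]
  have h1 : ‖(y : ℂ) + u * x‖ ^ 2 - (x * ‖(r : ℂ) + u‖) ^ 2 =
      (y - r * x) * (y + r * x + 2 * (x * u.re)) := by
    rw [mul_pow, ← Complex.normSq_eq_norm_sq, ← Complex.normSq_eq_norm_sq, Complex.normSq_apply,
      Complex.normSq_apply]
    simp
    ring
  have h2 : 0 ≤ (y - r * x) * (y + r * x + 2 * (x * u.re)) := by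
    have h3 : x ≤ r * x := by nlinarith
    have h4 : -x ≤ x * u.re := by nlinarith
    exact mul_nonneg (by linarith) (by linarith)
  linarith

lemma half_add_mul_norm_le {x y : ℝ} {u : ℂ} (hu : ‖u‖ = 1) :
    (x + y) / 2 * ‖((1 : ℝ) : ℂ) + u‖ ≤ ‖(y : ℂ) + u * x‖ := by
  refine le_of_sq_le_sq ?_ (norm_nonneg _)
  have hu2 : u.re * u.re + u.im * u.im = 1 := by
    rw [← Complex.normSq_apply, Complex.normSq_eq_norm_sq, hu, one_pow]
  have hre : u.re ≤ 1 := by nlinarith [mul_self_nonneg u.im]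
  have h1 : ‖(y : ℂ) + u * x‖ ^ 2 - ((x + y) / 2 * ‖((1 : ℝ) : ℂ) + u‖) ^ 2 =
      (x - y) ^ 2 / 2 * (1 - u.re) := by
    rw [mul_pow, ← Complex.normSq_eq_norm_sq, ← Complex.normSq_eq_norm_sq, Complex.normSq_apply,
      Complex.normSq_apply]
    simp
    linear_combination (x ^ 2 - ((x + y) / 2) ^ 2) * hu2
  have h2 : 0 ≤ (x - y) ^ 2 / 2 * (1 - u.re) := mul_nonneg (by positivity) (by linarith)
  linarith

lemma circleAverage_circleAverage_polarCombination_le {n s : ℕ} (hs : s ≠ 0) (hsn : s ≤ n)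
    {P : ℂ[X]} (hP : P.natDegree ≤ n) {p : ℝ} (hp : 0 < p) :
    Real.circleAverage (fun z ↦ Real.circleAverage (fun u ↦ ‖(polarZeroIter n s P).eval z +
      u * (z ^ s * (derivative^[s] P).eval z)‖ ^ p) 0 1) 0 1 ≤
      (n.descFactorial s : ℝ) ^ p * meanPow p P := by
  have hcont : Continuous (Function.uncurry fun z u : ℂ ↦ ‖(polarZeroIter n s P).eval z +
      u * (z ^ s * (derivative^[s] P).eval z)‖ ^ p) :=
    continuous_norm_add_mul_rpow hp.le (polarZeroIter n s P).continuous
      ((continuous_pow s).mul (derivative^[s] P).continuous)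
  rw [circleAverage_circleAverage_swap hcont]
  refine Real.circleAverage_mono_on_of_le_circle ?_ fun u hu ↦ ?_
  · refine ContinuousOn.circleIntegrable' (Continuous.continuousOn ?_)
    exact continuous_circleAverage_of_continuous (hcont.comp continuous_swap)
  · have hu1 : ‖u‖ ≤ 1 := by simpa using (le_of_eq (mem_sphere_zero_iff_norm.1 hu))
    simpa only [meanPow, eval_polarCombination] using
      meanPow_polarCombination_le hs hsn hu1 hP hp

/-- The sharp inequality for the `s`-th derivative of a polynomial without zeros in `‖z‖ < ρ`. -/
theorem meanPow_iterate_derivative_mul_le {ρ : ℝ} (hρ : 1 ≤ ρ) {n s : ℕ} (hs : s ≠ 0)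
    (hsn : s ≤ n) {P : ℂ[X]} (hdeg : P.natDegree ≤ n)
    (hP : ∀ z : ℂ, ‖z‖ < ρ → P.eval z ≠ 0) {p : ℝ} (hp : 0 < p) :
    meanPow p (derivative^[s] P) * meanPow p (C ((ρ : ℂ) ^ s) + X) ≤
      (n.descFactorial s : ℝ) ^ p * meanPow p P := by
  refine le_trans ?_ (circleAverage_circleAverage_polarCombination_le hs hsn hdeg hp)
  rw [mul_comm, meanPow.eq_1 p (derivative^[s] P), ← smul_eq_mul, ← Real.circleAverage_fun_smul]
  refine Real.circleAverage_mono ?_ ?_ fun z hz ↦ ?_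
  · exact ((continuous_norm_eval_rpow hp.le _).const_smul (_ : ℝ)).continuousOn.circleIntegrable'
  · refine ContinuousOn.circleIntegrable' (Continuous.continuousOn ?_)
    exact continuous_circleAverage_of_continuous (continuous_norm_add_mul_rpow hp.le
      (polarZeroIter n s P).continuous ((continuous_pow s).mul (derivative^[s] P).continuous))
  · have hz1 : ‖z‖ = 1 := by simpa using hz
    have hnorm : ‖z ^ s * (derivative^[s] P).eval z‖ = ‖(derivative^[s] P).eval z‖ := by
      rw [norm_mul, norm_pow, hz1, one_pow, one_mul]
    have hle := pow_mul_norm_iterate_derivative_le (zero_lt_one.trans_le hρ) hs hsn hdeg hP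
      (hz1.trans_le hρ)
    have h := rpow_mul_meanPow_le hp.le (a := z ^ s * (derivative^[s] P).eval z)
      (b := (polarZeroIter n s P).eval z) (r := ρ ^ s) (norm_nonneg ((derivative^[s] P).eval z))
      fun u hu ↦ by
        rw [hnorm]
        exact mul_norm_add_le_of_mul_le (norm_nonneg _) (one_le_pow₀ hρ) hle hu
    rw [smul_eq_mul, mul_comm]
    simpa only [Complex.ofReal_pow] using h

lemma polarZeroIter_self {m : ℕ} {Q : ℂ[X]} (hQ : Q.natDegree ≤ m) :
    polarZeroIter m m Q = C (m.factorial * Q.coeff 0) := by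
  ext j
  rw [coeff_polarZeroIter, coeff_C]
  split_ifs with hj
  · rw [hj, Nat.cast_zero, sub_zero, descPochhammer_eval_eq_descFactorial, Nat.descFactorial_self]
  · rcases le_or_gt j m with hjm | hjm
    · rw [← Nat.cast_sub hjm, descPochhammer_eval_eq_descFactorial,
        Nat.descFactorial_of_lt (by omega), Nat.cast_zero, zero_mul]
    · rw [coeff_eq_zero_of_natDegree_lt (by omega), mul_zero]

lemma iterate_derivative_natDegree_le {m : ℕ} {Q : ℂ[X]} (hQ : Q.natDegree ≤ m) :
    derivative^[m] Q = C (m.factorial * Q.coeff m) := by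
  ext j
  rw [coeff_iterate_derivative, coeff_C, nsmul_eq_mul]
  split_ifs with hj
  · rw [hj, zero_add, Nat.descFactorial_self]
  · rw [coeff_eq_zero_of_natDegree_lt (by omega), mul_zero]

/-- The case `s = m` of `polarCombination` keeps only the two extreme coefficients. -/
theorem half_add_rpow_mul_meanPow_le {m : ℕ} (hm : m ≠ 0) {Q : ℂ[X]} (hQ : Q.natDegree ≤ m)
    {p : ℝ} (hp : 0 < p) :
    ((‖Q.coeff m‖ + ‖Q.coeff 0‖) / 2) ^ p * meanPow p (1 + X) ≤ meanPow p Q := by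
  have hfac : (0 : ℝ) < m.factorial := Nat.cast_pos.2 m.factorial_pos
  have h := circleAverage_circleAverage_polarCombination_le hm le_rfl hQ hp
  simp only [polarZeroIter_self hQ, iterate_derivative_natDegree_le hQ, eval_C,
    Nat.descFactorial_self] at h
  refine le_of_mul_le_mul_left (le_trans ?_ h) (Real.rpow_pos_of_pos hfac p)
  rw [← mul_assoc, ← Real.mul_rpow hfac.le (by positivity),
    ← Real.circleAverage_const ((_ : ℝ) * meanPow p (1 + X)) 0 1]
  refine Real.circleAverage_mono (circleIntegrable_const _ _ _) ?_ fun z hz ↦ ?_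
  · refine ContinuousOn.circleIntegrable' (Continuous.continuousOn ?_)
    exact continuous_circleAverage_of_continuous (continuous_norm_add_mul_rpow hp.le
      continuous_const ((continuous_pow m).mul continuous_const))
  · have hz1 : ‖z‖ = 1 := by simpa using hz
    have hnorm : ‖z ^ m * (m.factorial * Q.coeff m)‖ = m.factorial * ‖Q.coeff m‖ := by
      rw [norm_mul, norm_pow, hz1, one_pow, one_mul, norm_mul, Complex.norm_natCast]
    have h := rpow_mul_meanPow_le hp.le (a := z ^ m * (m.factorial * Q.coeff m))
      (b := m.factorial * Q.coeff 0) (r := 1)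
      (k := m.factorial * ((‖Q.coeff m‖ + ‖Q.coeff 0‖) / 2)) (by positivity) fun u hu ↦ by
        rw [hnorm, norm_mul, Complex.norm_natCast]
        have := half_add_mul_norm_le (x := m.factorial * ‖Q.coeff m‖)
          (y := m.factorial * ‖Q.coeff 0‖) hu
        rwa [← mul_add, mul_div_assoc] at this
    simpa only [Complex.ofReal_one, map_one] using h

lemma meanPow_C_add_X_pos {p r : ℝ} (hp : 0 ≤ p) (hr : 0 ≤ r) : 0 < meanPow p (C (r : ℂ) + X) := by
  rw [meanPow, Real.circleAverage_def, smul_eq_mul]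
  refine mul_pos (by positivity) (intervalIntegral.integral_pos Real.two_pi_pos ?_ ?_ ?_)
  · exact ((continuous_norm_eval_rpow hp _).comp (continuous_circleMap 0 1)).continuousOn
  · intro θ _
    positivity
  · refine ⟨0, ⟨le_rfl, Real.two_pi_pos.le⟩, Real.rpow_pos_of_pos ?_ p⟩
    have : (r : ℂ) + 1 ≠ 0 := by
      exact_mod_cast (by positivity : r + 1 ≠ 0)
    rw [norm_pos_iff]
    simpa [circleMap_zero] using this

/-! ### The coefficient inequality -/

lemma pow_mul_norm_coeff_le {ρ : ℝ} (hρ : 0 < ρ) {P : ℂ[X]}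
    (hP : ∀ z : ℂ, ‖z‖ < ρ → P.eval z ≠ 0) (j : ℕ) :
    ρ ^ j * ‖P.coeff j‖ ≤ P.natDegree.choose j * ‖P.eval 0‖ := by
  have hρC : (ρ : ℂ) ≠ 0 := Complex.ofReal_ne_zero.2 hρ.ne'
  have hdeg : (P.comp (C (ρ : ℂ) * X)).natDegree = P.natDegree := by
    rw [natDegree_comp, natDegree_C_mul_X _ hρC, mul_one]
  have h := norm_coeff_le_choose_mul_mahlerMeasure j (P.comp (C (ρ : ℂ) * X))
  rw [mahlerMeasure_eq_norm_eval_zero, hdeg, comp_C_mul_X_coeff] at h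
  · rw [norm_mul, norm_pow, Complex.norm_real, Real.norm_eq_abs, abs_of_pos hρ] at h
    rw [mul_comm]
    simpa only [eval_comp, eval_mul, eval_C, eval_X, mul_zero] using h
  · intro z hz
    rw [eval_comp]
    refine hP _ ?_
    simp only [eval_mul, eval_C, eval_X, norm_mul, Complex.norm_real, Real.norm_eq_abs,
      abs_of_pos hρ]
    nlinarith

theorem corollary2 (n : ℕ) (P : ℂ[X]) (hdeg : P.degree = n) (ρ : ℝ) (hρ : 1 ≤ ρ)
    (hP : ∀ z : ℂ, ‖z‖ < ρ → P.eval z ≠ 0) (p : ℝ) (hp : 0 ≤ p) (s : ℕ) (hs : s < n) :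
    ‖P.coeff n‖ + ‖P.coeff s‖ / (n.choose s : ℝ) ≤
      2 * constC p s * (circleNorm p P / circleNorm p (C ((ρ : ℂ) ^ s) + X)) := by
  have hnat : P.natDegree = n := natDegree_eq_of_degree_eq_some hdeg
  have hρ0 : 0 < ρ := zero_lt_one.trans_le hρ
  have hchoose : (0 : ℝ) < n.choose s := Nat.cast_pos.2 (Nat.choose_pos hs.le)
  set S := ‖P.coeff n‖ + ‖P.coeff s‖ / (n.choose s : ℝ) with hS
  rcases hp.eq_or_lt with rfl | hp
  · -- Both coefficients are bounded by the Mahler measure of `P`, which is `‖P 0‖`.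
    have hone : (1 + X : ℂ[X]).mahlerMeasure = 1 := by
      rw [add_comm, ← C_1, mahlerMeasure_X_add_C, norm_one, max_self]
    have hconst : constC 0 s = 1 := by
      simp [constC, circleNorm, hone]
    have hden : circleNorm 0 (C ((ρ : ℂ) ^ s) + X) = ρ ^ s := by
      rw [circleNorm, if_pos rfl, add_comm, mahlerMeasure_X_add_C, norm_pow, Complex.norm_real,
        Real.norm_eq_abs, abs_of_pos hρ0, max_eq_right (one_le_pow₀ hρ)]
    have hnum : circleNorm 0 P = ‖P.eval 0‖ := by
      rw [circleNorm, if_pos rfl]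
      exact mahlerMeasure_eq_norm_eval_zero fun z hz ↦ hP z (hz.trans_le hρ)
    rw [hconst, hden, hnum, mul_one, two_mul]
    have h1 := pow_mul_norm_coeff_le hρ0 hP n
    have h2 := pow_mul_norm_coeff_le hρ0 hP s
    rw [hnat] at h1 h2
    rw [Nat.choose_self, Nat.cast_one, one_mul] at h1
    have h3 : ρ ^ s ≤ ρ ^ n := pow_le_pow_right₀ hρ hs.le
    refine add_le_add ?_ ?_
    · rw [le_div_iff₀ (by positivity), mul_comm]
      exact (mul_le_mul_of_nonneg_right h3 (norm_nonneg _)).trans h1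
    · rw [div_le_div_iff₀ hchoose (by positivity)]
      linarith
  · have hone : (1 + X : ℂ[X]) = C ((1 : ℝ) : ℂ) + X := by simp
    have hM1 : 0 < meanPow p (1 + X) := hone ▸ meanPow_C_add_X_pos hp.le zero_le_one
    have hMρ : 0 < meanPow p (C ((ρ : ℂ) ^ s) + X) := by
      rw [← Complex.ofReal_pow]
      exact meanPow_C_add_X_pos hp.le (by positivity)
    have hS0 : 0 ≤ S := by positivity
    -- Pass from an inequality between `p`-th means to one between the norms.
    have hroot : ∀ {M : ℝ}, 0 < M → (S / 2) ^ p * M ≤ meanPow p P →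
        S / 2 * M ^ (1 / p) ≤ circleNorm p P := by
      intro M hM h
      have h' := Real.rpow_le_rpow (by positivity) h (by positivity : 0 ≤ 1 / p)
      rw [Real.mul_rpow (by positivity) hM.le, ← Real.rpow_mul (by positivity),
        mul_one_div_cancel hp.ne', Real.rpow_one] at h'
      rwa [circleNorm_eq_meanPow hp.ne']
    rcases Nat.eq_zero_or_pos s with rfl | hs0
    · have h := hroot hM1 (by
        have := half_add_rpow_mul_meanPow_le (by omega : n ≠ 0) hnat.le hp
        simpa [hS] using this)
      have hden : circleNorm p (C ((ρ : ℂ) ^ 0) + X) = meanPow p (1 + X) ^ (1 / p) := by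
        rw [circleNorm_eq_meanPow hp.ne', pow_zero, C_1]
      rw [constC, if_pos rfl, mul_one, hden, ← mul_div_assoc,
        le_div_iff₀ (Real.rpow_pos_of_pos hM1 _)]
      linarith
    · have hfac : (n.descFactorial s : ℝ) = s.factorial * n.choose s := by
        rw [Nat.descFactorial_eq_factorial_mul_choose, Nat.cast_mul]
      have hdpos : (0 : ℝ) < n.descFactorial s := by
        rw [hfac]
        positivity
      have hQdeg : (derivative^[s] P).natDegree ≤ n - s :=
        (natDegree_iterate_derivative P s).trans (by rw [hnat])
      have hA := half_add_rpow_mul_meanPow_le (by omega : n - s ≠ 0) hQdeg hp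
      have hB := meanPow_iterate_derivative_mul_le hρ hs0.ne' hs.le hnat.le hP hp
      have hsum : (‖(derivative^[s] P).coeff (n - s)‖ + ‖(derivative^[s] P).coeff 0‖) / 2 =
          n.descFactorial s * (S / 2) := by
        rw [coeff_iterate_derivative, coeff_iterate_derivative, zero_add, Nat.sub_add_cancel hs.le,
          Nat.descFactorial_self, nsmul_eq_mul, nsmul_eq_mul, norm_mul, norm_mul,
          Complex.norm_natCast, Complex.norm_natCast, hS, hfac]
        field_simp
      rw [hsum, Real.mul_rpow hdpos.le (by positivity)] at hA
      have h := hroot (mul_pos hM1 hMρ) (by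
        have h1 := (mul_le_mul_of_nonneg_right hA hMρ.le).trans hB
        rw [mul_assoc, mul_assoc] at h1
        exact le_of_mul_le_mul_left h1 (Real.rpow_pos_of_pos hdpos p))
      rw [constC, if_neg hs0.ne', circleNorm_eq_meanPow hp.ne' (1 + X),
        circleNorm_eq_meanPow hp.ne' (C _ + X)]
      rw [Real.mul_rpow hM1.le hMρ.le] at h
      have hN1 := Real.rpow_pos_of_pos hM1 (1 / p)
      have hNρ := Real.rpow_pos_of_pos hMρ (1 / p)
      rw [mul_one_div, div_mul_div_comm, le_div_iff₀ (mul_pos hN1 hNρ)]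
      linarith
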